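/- For a convex polytope $P$ (in some $\mathbb{R}^N$) and a positive integer $m$, let $f^m(P)=(f^m_{-1}(P),f^m_0(P),\ldots,f^m_{m-2}(P))$, where $f^m_i(P)$ is the number of faces of $P$ whose dimension is congruent to $i$ modulo $m$; the empty face (of dimension $-1$) and $P$ itself are counted as faces. In particular $f^1(P)$ is the total number of faces of $P$. A $d$-polytope is called stacked if it is obtained from a $d$-simplex by finitely many (possibly zero) steps, each of which stacks a pyramid over a facet $F$ of the current polytope $P$, that is, replaces $P$ by the convex hull of $P\cup\{x\}$, where $x$ is a point of the affine hull of $P$ lying beyond $F$ and beneath every other facet of $P$ (strictly on the other side, respectively strictly on the same side as $P$, of the supporting hyperplanes relative to the affine hull of $P$). Theorem. Let $n\ge 0$ be a fixed integer, and for every $k\ge 2$ let $S_k$ be any stacked $k$-polytope with $k+1+n$ vertices. Then for every positive integer $m$, $$\lim_{k\to\infty}\frac{f^m(S_k)}{f^1(S_k)}=\Big(\frac1m,\ldots,\frac1m\Big).$$ -/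

import Mathlib

open Filter Topology

section Polytopes

variable {E : Type*} [AddCommGroup E] [Module ℝ E] [TopologicalSpace E]

open Classical in
/-- The dimension of a (convex) set: the dimension of its affine hull, with `dim ∅ = -1`. -/
noncomputable def convexDim (A : Set E) : ℤ :=
  if A = ∅ then -1 else (Module.finrank ℝ (vectorSpan ℝ A) : ℤ)

/-- `F` is a face of the polytope `P`: either empty, or the set of all maximizers over `P` of some
linear functional. The improper faces `∅` and `P` itself (zero functional) are included. -/
def IsFace (P F : Set E) : Prop := IsExposed ℝ P F

/-- The `f`-vector: `fVector P i` is the number of faces of `P` of dimension `i`. -/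
noncomputable def fVector (P : Set E) (i : ℤ) : ℕ :=
  {F : Set E | IsFace P F ∧ convexDim F = i}.ncard

/-- The `m`-modular `f`-vector. Its components are indexed by `i = -1, 0, …, m - 2`; the entry at
`j : Fin m` is the component with `i = j - 1`, that is, the number of faces of `P` whose dimension
is congruent to `j - 1` modulo `m`. -/
noncomputable def modularFVector (m : ℕ) (P : Set E) (j : Fin m) : ℕ :=
  {F : Set E | IsFace P F ∧ convexDim F ≡ (j : ℤ) - 1 [ZMOD (m : ℤ)]}.ncard

/-- `F` is a facet of the polytope `P`: a face of dimension `dim P - 1`. -/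
def IsFacet (P F : Set E) : Prop :=
  IsFace P F ∧ convexDim F = convexDim P - 1

/-- The point `x` (of the affine hull of `P`) is beyond the facet `F` of `P`: the hyperplane
supporting `P` along `F` strictly separates `x` from the rest of `P`. -/
def IsBeyond (P F : Set E) (x : E) : Prop :=
  ∃ l : StrongDual ℝ E, F = {y ∈ P | ∀ z ∈ P, l z ≤ l y} ∧ ∀ y ∈ F, l y < l x

/-- The point `x` (of the affine hull of `P`) is beneath the facet `F` of `P`: it is strictly on
the same side as `P` of the hyperplane supporting `P` along `F`. -/
def IsBeneath (P F : Set E) (x : E) : Prop :=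
  ∃ l : StrongDual ℝ E, F = {y ∈ P | ∀ z ∈ P, l z ≤ l y} ∧ ∀ y ∈ F, l x < l y

/-- `Q` is obtained from the polytope `P` by stacking a pyramid over a facet `F` of `P`: the apex
`x` lies in the affine hull of `P`, beyond `F` and beneath all other facets of `P`, and `Q` is the
convex hull of `P` and `x`. -/
def IsStackingOver (P Q : Set E) : Prop :=
  ∃ (F : Set E) (x : E), IsFacet P F ∧ x ∈ affineSpan ℝ P ∧ IsBeyond P F x ∧
    (∀ G : Set E, IsFacet P G → G ≠ F → IsBeneath P G x) ∧ Q = convexHull ℝ (insert x P)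

/-- Stacked `d`-polytopes: those obtained from a `d`-simplex by finitely many (possibly zero)
steps, each stacking a pyramid over a facet of the polytope reached so far. -/
inductive IsStackedPolytope (d : ℕ) : Set E → Prop
  | simplex (p : Fin (d + 1) → E) (hp : AffineIndependent ℝ p) :
      IsStackedPolytope d (convexHull ℝ (Set.range p))
  | stack (P Q : Set E) (hP : IsStackedPolytope d P) (hQ : IsStackingOver P Q) :
      IsStackedPolytope d Q

end Polytopes

/-!
Let `d ≥ 2`. Stacking a pyramid over a facet of a stacked `d`-polytope, which is a simplex with `d`
vertices, destroys this facet and creates one new face for each of its proper subsets. Hence, up to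
a bounded error per stacking, a stacking adds to the number of faces of dimension `i` the number of
`i`-element subsets of a `d`-element set. In particular it adds exactly one vertex, so that `n`
stackings lead to `d + 1 + n` vertices, and the number of faces with dimension in a given residue
class mod `m` is, up to a bounded error, a sum of binomial coefficients `(d + 1).choose i` plus `n`
times a similar sum of `d.choose i`. By the roots of unity filter these sums are `2 ^ (d + 1) / m`
and `2 ^ d / m` up to lower order, whatever the residue class
(`tendsto_subsetCount_div_two_pow`), so every modular entry is asymptotic to `(n + 2) / m * 2 ^ d`.

The geometric content is the description of the faces after a stacking. A polytope is encoded by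
the finite set `V` of its vertices together with the family `𝓕` of vertex sets of its facets
(`IsFacetSystem`), and faces are encoded by the subsets of `V` on which a functional is maximal
(`Exposes`). The key invariant is that every ridge lies in a second facet. It serves twice. First,
it gives the functionals that expose the facets of the pyramid, as positive combinations of
functionals of two adjacent facets separated by the apex (`Exposes.insert_erase`). Second, it
determines the signs of the barycentric coordinates of an old vertex with respect to the simplex
spanned by the stacked facet and the apex, and these signs exclude any further faces
(`IsFacetSystem.eq_level_of_apex_mem`). That all of this persists under stacking is
`IsFacetSystem.stack`, and the resulting face count is `IsStackedPolytope.exists_ncard_faces`.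
-/

/-! ### Affine spans and affine independence -/

section AffineLemmas

variable {E : Type*} [NormedAddCommGroup E] [NormedSpace ℝ E]

theorem exists_weights_of_mem_affineSpan {S : Finset E} {v : E}
    (hv : v ∈ affineSpan ℝ (S : Set E)) :
    ∃ w : E → ℝ, ∑ s ∈ S, w s = 1 ∧ ∑ s ∈ S, w s • s = v := by
  classical
  have hr : (S : Set E) = Set.range (fun s : S => (s : E)) := by simp
  rw [hr] at hv
  obtain ⟨w, hw, rfl⟩ := eq_affineCombination_of_mem_affineSpan_of_fintype hv
  have key : ∀ s : S, (fun e => if h : e ∈ S then w ⟨e, h⟩ else 0) (s : E) = w s := by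
    rintro ⟨s, hs⟩
    simp [hs]
  refine ⟨fun e => if h : e ∈ S then w ⟨e, h⟩ else 0, ?_, ?_⟩
  · rw [← Finset.sum_coe_sort S, Finset.sum_congr rfl fun s _ => key s]
    exact hw
  · rw [Finset.affineCombination_eq_linear_combination _ _ _ hw, ← Finset.sum_coe_sort S]
    exact Finset.sum_congr rfl fun s _ => by rw [key s]

/-- On an affinely independent set, every function is the restriction of a continuous affine map. -/
theorem AffineIndependent.exists_dual_eq_add_const [FiniteDimensional ℝ E] {A : Finset E}
    (hA : AffineIndependent ℝ ((↑) : A → E)) (g : E → ℝ) :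
    ∃ (l : StrongDual ℝ E) (c : ℝ), ∀ a ∈ A, l a = g a + c := by
  classical
  rcases A.eq_empty_or_nonempty with rfl | ⟨a₀, ha₀⟩
  · exact ⟨0, 0, by simp⟩
  have h := (affineIndependent_iff_linearIndependent_vsub ℝ _ (⟨a₀, ha₀⟩ : A)).1 hA
  obtain ⟨f, hf⟩ := LinearMap.exists_extend
    ((Module.Basis.span h).constr ℝ fun i => g (i : A) - g a₀)
  refine ⟨LinearMap.toContinuousLinearMap f, f a₀ - g a₀, fun a ha => ?_⟩
  by_cases haa : a = a₀
  · subst haa; simp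
  have h1 := congrArg
    (fun φ => φ (Module.Basis.span h ⟨⟨a, ha⟩, fun e => haa (congrArg Subtype.val e)⟩)) hf
  rw [Module.Basis.constr_basis] at h1
  simp only [LinearMap.comp_apply, Submodule.subtype_apply, Module.Basis.span_apply] at h1
  simp only [vsub_eq_sub, map_sub] at h1
  simp only [LinearMap.coe_toContinuousLinearMap']
  linarith

theorem StrongDual.eq_of_mem_affineSpan {S : Set E} {l : StrongDual ℝ E} {c : ℝ}
    (h : ∀ s ∈ S, l s = c) {v : E} (hv : v ∈ affineSpan ℝ S) : l v = c := by
  refine affineSpan_induction (p := fun v => l v = c) hv h ?_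
  intro r u v w hu hv hw
  simp [hu, hv, hw]

/-- A point off a hyperplane spanned by affinely independent points completes them to an affine
basis of the affine span of `V`. -/
theorem affineSpan_insert_eq_of_card_eq_finrank [FiniteDimensional ℝ E] [DecidableEq E]
    {V A : Finset E}
    (hAV : A ⊆ V) (hA : AffineIndependent ℝ ((↑) : A → E))
    (hcard : A.card = Module.finrank ℝ (vectorSpan ℝ (V : Set E)))
    {l : StrongDual ℝ E} {c : ℝ} (hl : ∀ a ∈ A, l a = c) {z : E}
    (hz : z ∈ affineSpan ℝ (V : Set E)) (hlz : l z ≠ c) :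
    AffineIndependent ℝ ((↑) : ↥(insert z A : Finset E) → E) ∧
      affineSpan ℝ ((insert z A : Finset E) : Set E) = affineSpan ℝ (V : Set E) := by
  have hzA : z ∉ affineSpan ℝ (A : Set E) := fun h => hlz (StrongDual.eq_of_mem_affineSpan hl h)
  have hz' : z ∉ A := fun h => hzA (subset_affineSpan ℝ _ h)
  have hi : AffineIndependent ℝ ((↑) : ↥(insert z A : Finset E) → E) := by
    have := AffineIndependent.affineIndependent_of_notMem_span
      (k := ℝ) (p := ((↑) : ↥(insert z A : Finset E) → E)) (i := ⟨z, by simp⟩) ?_ ?_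
    · exact this
    · have e : ∀ y : {y : (insert z A : Finset E) // y ≠ ⟨z, by simp⟩},
          ((y : (insert z A : Finset E)) : E) ∈ A := by
        rintro ⟨⟨y, hy⟩, hyz⟩
        rcases Finset.mem_insert.1 hy with rfl | h
        · exact absurd rfl hyz
        · exact h
      exact hA.comp_embedding ⟨fun y => ⟨_, e y⟩, fun a b hab => by
        simp only [Subtype.mk.injEq] at hab
        exact Subtype.ext (Subtype.ext hab)⟩
    · refine fun h => hzA (affineSpan_mono ℝ ?_ h)
      rintro _ ⟨⟨y, hy⟩, hyz, rfl⟩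
      rcases Finset.mem_insert.1 hy with rfl | h
      · exact absurd rfl hyz
      · exact h
  refine ⟨hi, ?_⟩
  have hsub : affineSpan ℝ ((insert z A : Finset E) : Set E) ≤ affineSpan ℝ (V : Set E) := by
    rw [affineSpan_le]
    intro y hy
    rcases Finset.mem_insert.1 (Finset.mem_coe.1 hy) with rfl | h
    · exact hz
    · exact subset_affineSpan ℝ _ (hAV h)
  have hr : Set.range ((↑) : ↥(insert z A : Finset E) → E) = ((insert z A : Finset E) : Set E) := by
    ext; simp
  rw [← hr] at hsub ⊢
  refine hi.affineSpan_eq_of_le_of_card_eq_finrank_add_one hsub ?_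
  rw [direction_affineSpan, Fintype.card_coe, Finset.card_insert_of_notMem hz', hcard]

end AffineLemmas

/-! ### Exposed faces of the convex hull of a finite set -/

section ExposedSubsets

variable {E : Type*} [NormedAddCommGroup E] [NormedSpace ℝ E]

/-- The functional `l` and the level `c` expose the subset `A` of the finite point set `V`: on `V`
we have `l ≤ c`, with equality exactly on `A`. The empty set is exposed by any level above the
maximum of `l`, and `V` by the zero functional. -/
structure Exposes (V A : Finset E) (l : StrongDual ℝ E) (c : ℝ) : Prop where
  subset : A ⊆ V
  eq : ∀ v ∈ A, l v = c
  lt : ∀ v ∈ V, v ∉ A → l v < c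

namespace Exposes

variable {V A : Finset E} {l : StrongDual ℝ E} {c : ℝ}

theorem le (h : Exposes V A l c) {v : E} (hv : v ∈ V) : l v ≤ c := by
  by_cases hA : v ∈ A
  · exact (h.eq v hA).le
  · exact (h.lt v hv hA).le

theorem le_of_mem_convexHull (h : Exposes V A l c) {y : E} (hy : y ∈ convexHull ℝ (V : Set E)) :
    l y ≤ c :=
  convexHull_min (fun _ hv => h.le hv) (convex_halfSpace_le l.isLinear c) hy

theorem eq_of_mem_convexHull (h : Exposes V A l c) {y : E} (hy : y ∈ convexHull ℝ (A : Set E)) :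
    l y = c :=
  convexHull_min (fun v hv => h.eq v hv) (convex_hyperplane l.isLinear c) hy

theorem convexHull_eq (h : Exposes V A l c) :
    convexHull ℝ (A : Set E) = {y ∈ convexHull ℝ (V : Set E) | l y = c} := by
  refine Set.Subset.antisymm
    (fun y hy => ⟨convexHull_mono (Finset.coe_subset.2 h.subset) hy, h.eq_of_mem_convexHull hy⟩) ?_
  rintro y ⟨hy, hly⟩
  rw [Finset.convexHull_eq] at hy
  obtain ⟨w, hw0, hw1, rfl⟩ := hy
  -- The weighted average of the nonnegative defects `c - l v` vanishes, so each term does.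
  have hsum : ∑ v ∈ V, w v * (c - l v) = 0 := by
    rw [Finset.centerMass_eq_of_sum_1 _ _ hw1] at hly
    simp only [id, map_sum, map_smul, smul_eq_mul] at hly
    simp only [mul_sub, Finset.sum_sub_distrib, ← Finset.sum_mul, hw1, hly]
    ring
  have hzero := (Finset.sum_eq_zero_iff_of_nonneg fun v hv =>
    mul_nonneg (hw0 v hv) (sub_nonneg.2 (h.le hv))).1 hsum
  have hw : ∀ v ∈ V, v ∉ A → w v = 0 := fun v hv hvA =>
    (mul_eq_zero.1 (hzero v hv)).resolve_right (sub_pos.2 (h.lt v hv hvA)).ne'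
  rw [← Finset.centerMass_subset id h.subset hw]
  refine (convex_convexHull ℝ _).centerMass_mem (fun i hi => hw0 i (h.subset hi)) ?_
    fun i hi => subset_convexHull ℝ _ hi
  rw [Finset.sum_subset h.subset hw, hw1]
  exact one_pos

theorem mem_iff_mem_convexHull (h : Exposes V A l c) {v : E} (hv : v ∈ V) :
    v ∈ A ↔ v ∈ convexHull ℝ (A : Set E) := by
  refine ⟨fun hA => subset_convexHull ℝ _ hA, fun hA => ?_⟩
  by_contra hvA
  exact (h.lt v hv hvA).ne (h.eq_of_mem_convexHull hA)

theorem eq_of_convexHull_eq {B : Finset E} {l' : StrongDual ℝ E} {c' : ℝ}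
    (hA : Exposes V A l c) (hB : Exposes V B l' c')
    (h : convexHull ℝ (A : Set E) = convexHull ℝ (B : Set E)) : A = B := by
  ext v
  refine ⟨fun hv => ?_, fun hv => ?_⟩
  · rw [hB.mem_iff_mem_convexHull (hA.subset hv), ← h]
    exact subset_convexHull ℝ _ hv
  · rw [hA.mem_iff_mem_convexHull (hB.subset hv), h]
    exact subset_convexHull ℝ _ hv

/-- A functional whose maximizers on the polytope form the exposed set `convexHull A` exposes the
vertex set `A`. -/
theorem of_convexHull_eq_maximizers (hA : Exposes V A l c) {m : StrongDual ℝ E} {a : E} (ha : a ∈ A)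
    (h : convexHull ℝ (A : Set E) =
      {y ∈ convexHull ℝ (V : Set E) | ∀ z ∈ convexHull ℝ (V : Set E), m z ≤ m y}) :
    Exposes V A m (m a) := by
  have hmax : ∀ v ∈ A, ∀ z ∈ convexHull ℝ (V : Set E), m z ≤ m v := fun v hv => by
    have : v ∈ convexHull ℝ (A : Set E) := subset_convexHull ℝ _ hv
    rw [h] at this
    exact this.2
  have hV : ∀ v ∈ V, v ∈ convexHull ℝ (V : Set E) := fun v hv => subset_convexHull ℝ _ hv
  refine ⟨hA.subset, fun v hv => le_antisymm (hmax a ha v (hV v (hA.subset hv)))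
    (hmax v hv a (hV a (hA.subset ha))), fun v hv hvA => ?_⟩
  refine lt_of_le_of_ne (hmax a ha v (hV v hv)) fun e => hvA ?_
  rw [hA.mem_iff_mem_convexHull hv, h]
  exact ⟨hV v hv, fun z hz => e ▸ hmax a ha z hz⟩

/-- Every subset of an exposed simplex is exposed: perturb a large multiple of the exposing
functional by one that separates the subset from the remaining vertices of the simplex. -/
theorem exists_of_subset [FiniteDimensional ℝ E] (h : Exposes V A l c)
    (hA : AffineIndependent ℝ ((↑) : A → E)) {W : Finset E} (hW : W ⊆ A) :
    ∃ (l' : StrongDual ℝ E) (c' : ℝ), Exposes V W l' c' := by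
  classical
  obtain ⟨m, b, hm⟩ := hA.exists_dual_eq_add_const fun a => if a ∈ W then 0 else -1
  have hev : ∀ᶠ N : ℝ in atTop, ∀ v ∈ V \ A, m v - b < N * (c - l v) := by
    rw [eventually_all_finset]
    intro v hv
    obtain ⟨hvV, hvA⟩ := Finset.mem_sdiff.1 hv
    exact (tendsto_id.atTop_mul_const (sub_pos.2 (h.lt v hvV hvA))).eventually_gt_atTop _
  obtain ⟨N, hN⟩ := hev.exists
  refine ⟨N • l + m, N * c + b, hW.trans h.subset, fun v hv => ?_, fun v hv hvW => ?_⟩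
  · simp [h.eq v (hW hv), hm v (hW hv), hv]
  · by_cases hvA : v ∈ A
    · simp [h.eq v hvA, hm v hvA, hvW]
    · have := hN v (Finset.mem_sdiff.2 ⟨hv, hvA⟩)
      simp only [add_apply, smul_apply, smul_eq_mul]
      linarith

end Exposes

theorem exposes_self (V : Finset E) : Exposes V V 0 0 :=
  ⟨subset_rfl, by simp, fun _ h h' => absurd h h'⟩

theorem exposes_empty (V : Finset E) : Exposes V ∅ 0 1 :=
  ⟨by simp, by simp, by simp⟩

/-- The faces of a polytope are the convex hulls of the exposed subsets of a finite generating set. -/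
theorem isFace_convexHull_iff {V : Finset E} (hV : V.Nonempty) {F : Set E} :
    IsFace (convexHull ℝ (V : Set E)) F ↔
      ∃ (W : Finset E) (l : StrongDual ℝ E) (c : ℝ), Exposes V W l c ∧
        F = convexHull ℝ (W : Set E) := by
  classical
  constructor
  · intro hF
    rcases F.eq_empty_or_nonempty with rfl | hne
    · exact ⟨∅, 0, 1, exposes_empty V, by simp⟩
    obtain ⟨l, rfl⟩ := hF hne
    obtain ⟨v₀, hv₀, hmax⟩ := V.exists_max_image l hV
    have hex : Exposes V (V.filter fun v => l v = l v₀) l (l v₀) :=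
      ⟨Finset.filter_subset _ _, fun v hv => (Finset.mem_filter.1 hv).2, fun v hv hv' =>
        lt_of_le_of_ne (hmax v hv) fun e => hv' (Finset.mem_filter.2 ⟨hv, e⟩)⟩
    refine ⟨_, l, l v₀, hex, ?_⟩
    rw [hex.convexHull_eq]
    ext y
    constructor
    · rintro ⟨hy, hy'⟩
      exact ⟨hy, le_antisymm (hex.le_of_mem_convexHull hy) (hy' _ (subset_convexHull ℝ _ hv₀))⟩
    · rintro ⟨hy, hy'⟩
      exact ⟨hy, fun z hz => (hex.le_of_mem_convexHull hz).trans hy'.ge⟩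
  · rintro ⟨W, l, c, h, rfl⟩ ⟨x, hx⟩
    refine ⟨l, ?_⟩
    have hxc := h.eq_of_mem_convexHull hx
    rw [h.convexHull_eq] at hx ⊢
    ext y
    constructor
    · rintro ⟨hy, hy'⟩
      exact ⟨hy, fun z hz => (h.le_of_mem_convexHull hz).trans hy'.ge⟩
    · rintro ⟨hy, hy'⟩
      exact ⟨hy, le_antisymm (h.le_of_mem_convexHull hy) (hxc ▸ hy' x hx.1)⟩

theorem vectorSpan_convexHull (s : Set E) : vectorSpan ℝ (convexHull ℝ s) = vectorSpan ℝ s := by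
  rw [← direction_affineSpan, affineSpan_convexHull, direction_affineSpan]

theorem convexDim_convexHull {s : Set E} (hs : s.Nonempty) :
    convexDim (convexHull ℝ s) = Module.finrank ℝ (vectorSpan ℝ s) := by
  rw [convexDim, if_neg (by simpa using hs.ne_empty), vectorSpan_convexHull]

theorem AffineIndependent.convexDim_convexHull {A : Finset E}
    (hA : AffineIndependent ℝ ((↑) : A → E)) :
    convexDim (convexHull ℝ (A : Set E)) = (A.card : ℤ) - 1 := by
  rcases A.eq_empty_or_nonempty with rfl | hne
  · simp [convexDim]
  rw [_root_.convexDim_convexHull (by simpa using hne)]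
  have hr : Set.range ((↑) : A → E) = (A : Set E) := by simp
  have := hA.finrank_vectorSpan (n := A.card - 1) (by
    rw [Fintype.card_coe]; have := hne.card_pos; omega)
  rw [hr] at this
  rw [this]
  have := hne.card_pos
  omega

end ExposedSubsets

/-! ### Facets of simplicial polytopes and stacking -/

section FacetSystems

variable {E : Type*} [NormedAddCommGroup E] [NormedSpace ℝ E] [DecidableEq E]

/-- A combinatorial description of the simplicial `d`-polytope `convexHull V`: `𝓕` is the family of
the vertex sets of its facets. The proper exposed subsets of `V` lie in members of `𝓕`, and each
ridge `A.erase a` of a facet `A` lies in a second facet. -/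
structure IsFacetSystem (d : ℕ) (V : Finset E) (𝓕 : Finset (Finset E)) : Prop where
  finrank : Module.finrank ℝ (vectorSpan ℝ (V : Set E)) = d
  nonempty : 𝓕.Nonempty
  card : ∀ A ∈ 𝓕, A.card = d
  indep : ∀ A ∈ 𝓕, AffineIndependent ℝ ((↑) : A → E)
  exposed : ∀ A ∈ 𝓕, ∃ (l : StrongDual ℝ E) (c : ℝ), Exposes V A l c
  neighbor : ∀ A ∈ 𝓕, ∀ a ∈ A, ∃ B ∈ 𝓕, a ∉ B ∧ A.erase a ⊆ B
  eq_or_subset : ∀ (W : Finset E) (l : StrongDual ℝ E) (c : ℝ), Exposes V W l c →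
    W = V ∨ ∃ A ∈ 𝓕, W ⊆ A

/-- The facets after stacking a pyramid with apex `x` over the facet `A₀`. -/
def stackedFacets (𝓕 : Finset (Finset E)) (A₀ : Finset E) (x : E) : Finset (Finset E) :=
  𝓕.erase A₀ ∪ A₀.image fun a => insert x (A₀.erase a)

omit [NormedAddCommGroup E] [NormedSpace ℝ E] in
theorem mem_stackedFacets {𝓕 : Finset (Finset E)} {A₀ A : Finset E} {x : E} :
    A ∈ stackedFacets 𝓕 A₀ x ↔
      (A ≠ A₀ ∧ A ∈ 𝓕) ∨ ∃ a ∈ A₀, insert x (A₀.erase a) = A := by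
  simp [stackedFacets]

/-- A positive combination of functionals exposing two facets `A`, `B` with `A ∩ B = A.erase a`
that are separated by `x` exposes the new facet `insert x (A.erase a)`. -/
theorem Exposes.insert_erase {V A B : Finset E} {l l' : StrongDual ℝ E} {c c' : ℝ} {x a : E}
    (hA : Exposes V A l c) (hB : Exposes V B l' c') (haB : a ∉ B) (hsub : A.erase a ⊆ B)
    (hx : c < l x) (hx' : l' x < c') :
    Exposes (insert x V) (insert x (A.erase a)) ((c' - l' x) • l + (l x - c) • l')
      ((c' - l' x) * c + (l x - c) * c') := by
  refine ⟨Finset.insert_subset_insert _ ((Finset.erase_subset _ _).trans hA.subset), ?_, ?_⟩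
  · intro v hv
    simp only [add_apply, smul_apply, smul_eq_mul]
    rcases Finset.mem_insert.1 hv with rfl | hv
    · ring
    · rw [hA.eq v (Finset.mem_of_mem_erase hv), hB.eq v (hsub hv)]
  · intro v hv hv'
    rw [Finset.mem_insert, not_or] at hv'
    have hvV := (Finset.mem_insert.1 hv).resolve_left hv'.1
    simp only [add_apply, smul_apply, smul_eq_mul]
    by_cases hvA : v ∈ A
    · have hva : v = a := by
        by_contra h
        exact hv'.2 (Finset.mem_erase.2 ⟨h, hvA⟩)
      subst hva
      rw [hA.eq v hvA]
      have := mul_lt_mul_of_pos_left (hB.lt v hvV haB) (sub_pos.2 hx)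
      linarith
    · have h1 := mul_lt_mul_of_pos_left (hA.lt v hvV hvA) (sub_pos.2 hx')
      have h2 := mul_le_mul_of_nonneg_left (hB.le hvV) (sub_pos.2 hx).le
      linarith

namespace IsFacetSystem

variable {d : ℕ} {V : Finset E} {𝓕 : Finset (Finset E)}

theorem subset (h : IsFacetSystem d V 𝓕) {A : Finset E} (hA : A ∈ 𝓕) : A ⊆ V := by
  obtain ⟨l, c, hl⟩ := h.exposed A hA
  exact hl.subset

section Stack

variable [FiniteDimensional ℝ E] {A₀ : Finset E} {x : E} {l₀ : StrongDual ℝ E} {c₀ : ℝ}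

/-- An exposed subset after stacking that contains the apex `x` and a vertex `v` outside of the
facet `A₀` is everything. In the barycentric coordinates of `v` with respect to the simplex
`insert x A₀`, only the one of `x` is negative, as `x` is beneath the neighbours of `A₀`. A
functional which is maximal at `x` and at `v` is therefore constant on `A₀`. -/
theorem eq_level_of_apex_mem (h : IsFacetSystem d V 𝓕) (hA₀ : A₀ ∈ 𝓕)
    (hx : x ∈ affineSpan ℝ (V : Set E)) (hl₀ : Exposes V A₀ l₀ c₀) (hbeyond : c₀ < l₀ x)
    (hbeneath : ∀ B ∈ 𝓕, B ≠ A₀ → ∃ (l : StrongDual ℝ E) (c : ℝ), Exposes V B l c ∧ l x < c)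
    {m : StrongDual ℝ E} {b : ℝ} (hm : ∀ v ∈ V, m v ≤ b) (hmx : m x = b)
    {v : E} (hv : v ∈ V) (hvA : v ∉ A₀) (hmv : m v = b) {a : E} (ha : a ∈ A₀) : m a = b := by
  have hxA : x ∉ A₀ := fun hxA => hbeyond.ne' (hl₀.eq x hxA)
  obtain ⟨-, hspan⟩ := affineSpan_insert_eq_of_card_eq_finrank (h.subset hA₀) (h.indep A₀ hA₀)
    ((h.card A₀ hA₀).trans h.finrank.symm) hl₀.eq hx hbeyond.ne'
  have hv' : v ∈ affineSpan ℝ ((insert x A₀ : Finset E) : Set E) :=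
    hspan ▸ subset_affineSpan ℝ _ (Finset.mem_coe.2 hv)
  obtain ⟨w, hw1, hwv⟩ := exists_weights_of_mem_affineSpan hv'
  have eval : ∀ (l : StrongDual ℝ E) (c : ℝ),
      l v - c = w x * (l x - c) + ∑ a ∈ A₀, w a * (l a - c) := by
    intro l c
    rw [← Finset.sum_insert hxA (f := fun a => w a * (l a - c))]
    conv_lhs => rw [← hwv]
    simp only [map_sum, map_smul, smul_eq_mul, mul_sub, Finset.sum_sub_distrib, ← Finset.sum_mul,
      hw1, one_mul]
  have hwx : w x < 0 := by
    have e := eval l₀ c₀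
    rw [Finset.sum_eq_zero fun a ha => by rw [hl₀.eq a ha, sub_self, mul_zero], add_zero] at e
    have h1 := hl₀.lt v hv hvA
    by_contra hneg
    have := mul_nonneg (not_lt.1 hneg) (sub_pos.2 hbeyond).le
    linarith
  have hwa : ∀ a ∈ A₀, 0 < w a := by
    intro a ha
    obtain ⟨B, hB, haB, hsub⟩ := h.neighbor A₀ hA₀ a ha
    obtain ⟨l, c, hl, hlx⟩ := hbeneath B hB fun e => haB (e ▸ ha)
    have e := eval l c
    rw [Finset.sum_eq_single_of_mem a ha fun b hb hba => by
      rw [hl.eq b (hsub (Finset.mem_erase.2 ⟨hba, hb⟩)), sub_self, mul_zero]] at e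
    have h1 := hl.le hv
    have h2 := mul_pos_of_neg_of_neg hwx (sub_neg.2 hlx)
    have h3 := hl.lt a (h.subset hA₀ ha) haB
    by_contra hneg
    have := mul_nonneg_of_nonpos_of_nonpos (not_lt.1 hneg) (sub_neg.2 h3).le
    linarith
  have e := eval m b
  rw [hmx, hmv, sub_self, mul_zero, zero_add] at e
  have hz := (Finset.sum_eq_zero_iff_of_nonpos fun a ha =>
    mul_nonpos_of_nonneg_of_nonpos (hwa a ha).le
      (sub_nonpos.2 (hm a (h.subset hA₀ ha)))).1 e.symm a ha
  exact sub_eq_zero.1 ((mul_eq_zero.1 hz).resolve_left (hwa a ha).ne')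

/-- Every proper exposed subset after stacking lies in one of the new facets. -/
theorem eq_or_subset_stackedFacets (h : IsFacetSystem d V 𝓕) (hd : 0 < d) (hA₀ : A₀ ∈ 𝓕)
    (hx : x ∈ affineSpan ℝ (V : Set E)) (hl₀ : Exposes V A₀ l₀ c₀) (hbeyond : c₀ < l₀ x)
    (hbeneath : ∀ B ∈ 𝓕, B ≠ A₀ → ∃ (l : StrongDual ℝ E) (c : ℝ), Exposes V B l c ∧ l x < c)
    {H : Finset E} {m : StrongDual ℝ E} {b : ℝ} (hH : Exposes (insert x V) H m b) :
    H = insert x V ∨ ∃ A ∈ stackedFacets 𝓕 A₀ x, H ⊆ A := by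
  have hxV : x ∉ V := fun hxV => hbeyond.not_ge (hl₀.le hxV)
  have hspan := (affineSpan_insert_eq_of_card_eq_finrank (h.subset hA₀) (h.indep A₀ hA₀)
    ((h.card A₀ hA₀).trans h.finrank.symm) hl₀.eq hx hbeyond.ne').2
  -- A proper subset of `A₀`, together with `x`, lies in one of the facets of the pyramid.
  have hproper : ∀ W ⊆ A₀, W ≠ A₀ → ∃ A ∈ stackedFacets 𝓕 A₀ x, insert x W ⊆ A := by
    intro W hW hne
    obtain ⟨a, ha, haW⟩ := Finset.exists_of_ssubset (hW.ssubset_of_ne hne)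
    refine ⟨_, mem_stackedFacets.2 (Or.inr ⟨a, ha, rfl⟩), Finset.insert_subset_insert _ ?_⟩
    exact fun w hw => Finset.mem_erase.2 ⟨fun e => haW (e ▸ hw), hW hw⟩
  have hmV : ∀ v ∈ V, m v ≤ b := fun v hv => hH.le (Finset.mem_insert_of_mem hv)
  by_cases hxH : x ∈ H
  · -- A functional constant on `A₀` and `x` is constant on the polytope.
    have hall : (∀ a ∈ A₀, m a = b) → H = insert x V := by
      intro hA
      refine hH.subset.antisymm (Finset.insert_subset hxH fun v hv => ?_)
      by_contra hvH
      refine (hH.lt v (Finset.mem_insert_of_mem hv) hvH).ne (StrongDual.eq_of_mem_affineSpan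
        (S := ((insert x A₀ : Finset E) : Set E)) ?_
        (hspan ▸ subset_affineSpan ℝ _ (Finset.mem_coe.2 hv)))
      intro s hs
      rcases Finset.mem_insert.1 (Finset.mem_coe.1 hs) with rfl | hs
      · exact hH.eq s hxH
      · exact hA s hs
    by_cases hsub : H.erase x ⊆ A₀
    · by_cases he : H.erase x = A₀
      · exact Or.inl (hall fun a ha => hH.eq a (Finset.mem_of_mem_erase (he ▸ ha)))
      · have := hproper _ hsub he
        rw [Finset.insert_erase hxH] at this
        exact Or.inr this
    · obtain ⟨v, hv, hvA⟩ := Finset.not_subset.1 hsub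
      obtain ⟨hvx, hvH⟩ := Finset.mem_erase.1 hv
      have hvV := (Finset.mem_insert.1 (hH.subset hvH)).resolve_left hvx
      exact Or.inl (hall fun a ha => h.eq_level_of_apex_mem hA₀ hx hl₀ hbeyond hbeneath hmV
        (hH.eq x hxH) hvV hvA (hH.eq v hvH) ha)
  · have hmx : m x < b := hH.lt x (Finset.mem_insert_self _ _) hxH
    have hHV : Exposes V H m b :=
      ⟨fun v hv => (Finset.mem_insert.1 (hH.subset hv)).resolve_left fun e => hxH (e ▸ hv), hH.eq,
        fun v hv => hH.lt v (Finset.mem_insert_of_mem hv)⟩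
    right
    rcases h.eq_or_subset H m b hHV with rfl | ⟨A, hA, hHA⟩
    · exact absurd (StrongDual.eq_of_mem_affineSpan hH.eq hx) hmx.ne
    by_cases hAA : A = A₀
    · subst hAA
      by_cases he : H = A
      · -- On the affine hull, `m` is a positive multiple of `l₀` up to a constant.
        subst he
        obtain ⟨a, ha⟩ : H.Nonempty := Finset.card_pos.1 (by rw [h.card H hA]; exact hd)
        obtain ⟨B, hB, haB, hsub⟩ := h.neighbor H hA a ha
        obtain ⟨v, hvB, hvH⟩ : ∃ v ∈ B, v ∉ H := by
          by_contra! hBH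
          have := Finset.eq_of_subset_of_card_le hBH (by rw [h.card H hA, h.card B hB])
          exact haB (this ▸ ha)
        have hvV := h.subset hB hvB
        have hzero := StrongDual.eq_of_mem_affineSpan
          (S := ((insert x H : Finset E) : Set E)) (v := v)
          (l := (l₀ x - c₀) • m - (m x - b) • l₀)
          (c := (l₀ x - c₀) * b - (m x - b) * c₀) (by
            intro s hs
            simp only [sub_apply, smul_apply, smul_eq_mul]
            rcases Finset.mem_insert.1 (Finset.mem_coe.1 hs) with rfl | hs
            · ring
            · rw [hH.eq s hs, hl₀.eq s hs])
          (hspan ▸ subset_affineSpan ℝ _ (Finset.mem_coe.2 hvV))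
        simp only [sub_apply, smul_apply, smul_eq_mul] at hzero
        have h1 := mul_neg_of_pos_of_neg (sub_pos.2 hbeyond) (sub_neg.2 (hHV.lt v hvV hvH))
        have h2 := mul_pos_of_neg_of_neg (sub_neg.2 hmx) (sub_neg.2 (hl₀.lt v hvV hvH))
        linarith
      · obtain ⟨A, hA, hsub⟩ := hproper H hHA he
        exact ⟨A, hA, (Finset.subset_insert _ _).trans hsub⟩
    · exact ⟨A, mem_stackedFacets.2 (Or.inl ⟨hAA, hA⟩), hHA⟩

/-- Stacking a pyramid with apex `x` over the facet `A₀` turns facet systems into facet systems. -/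
theorem stack (h : IsFacetSystem d V 𝓕) (hd : 0 < d) (hA₀ : A₀ ∈ 𝓕)
    (hx : x ∈ affineSpan ℝ (V : Set E)) (hl₀ : Exposes V A₀ l₀ c₀) (hbeyond : c₀ < l₀ x)
    (hbeneath : ∀ B ∈ 𝓕, B ≠ A₀ → ∃ (l : StrongDual ℝ E) (c : ℝ), Exposes V B l c ∧ l x < c) :
    IsFacetSystem d (insert x V) (stackedFacets 𝓕 A₀ x) := by
  have hxV : x ∉ V := fun hxV => hbeyond.not_ge (hl₀.le hxV)
  have hxA : x ∉ A₀ := fun hxA => hxV (h.subset hA₀ hxA)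
  have hindep := (affineSpan_insert_eq_of_card_eq_finrank (h.subset hA₀) (h.indep A₀ hA₀)
    ((h.card A₀ hA₀).trans h.finrank.symm) hl₀.eq hx hbeyond.ne').1
  refine ⟨?_, ?_, ?_, ?_, ?_, ?_, fun W l c hW =>
    h.eq_or_subset_stackedFacets hd hA₀ hx hl₀ hbeyond hbeneath hW⟩
  · rw [Finset.coe_insert, ← direction_affineSpan, affineSpan_insert_eq_affineSpan ℝ hx,
      direction_affineSpan, h.finrank]
  · obtain ⟨a, ha⟩ : A₀.Nonempty := Finset.card_pos.1 (by rw [h.card A₀ hA₀]; exact hd)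
    exact ⟨_, mem_stackedFacets.2 (Or.inr ⟨a, ha, rfl⟩)⟩
  · intro A hA
    rcases mem_stackedFacets.1 hA with ⟨-, hA⟩ | ⟨a, ha, rfl⟩
    · exact h.card A hA
    · rw [Finset.card_insert_of_notMem fun e => hxA (Finset.mem_of_mem_erase e),
        Finset.card_erase_add_one ha, h.card A₀ hA₀]
  · intro A hA
    rcases mem_stackedFacets.1 hA with ⟨-, hA⟩ | ⟨a, ha, rfl⟩
    · exact h.indep A hA
    · exact hindep.mono
        (Finset.coe_subset.2 (Finset.insert_subset_insert _ (Finset.erase_subset _ _)))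
  · intro A hA
    rcases mem_stackedFacets.1 hA with ⟨hne, hA⟩ | ⟨a, ha, rfl⟩
    · obtain ⟨l, c, hl, hlx⟩ := hbeneath A hA hne
      refine ⟨l, c, hl.subset.trans (Finset.subset_insert _ _), hl.eq, fun v hv hvA => ?_⟩
      rcases Finset.mem_insert.1 hv with rfl | hv
      · exact hlx
      · exact hl.lt v hv hvA
    · obtain ⟨B, hB, haB, hsub⟩ := h.neighbor A₀ hA₀ a ha
      obtain ⟨l, c, hl, hlx⟩ := hbeneath B hB fun e => haB (e ▸ ha)
      exact ⟨_, _, hl₀.insert_erase hl haB hsub hbeyond hlx⟩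
  · intro A hA e he
    rcases mem_stackedFacets.1 hA with ⟨hne, hAF⟩ | ⟨a, ha, rfl⟩
    · obtain ⟨B, hB, heB, hsub⟩ := h.neighbor A hAF e he
      by_cases hBA : B = A₀
      · -- The ridge `A.erase e` of the stacked facet now lies in a facet of the pyramid.
        subst hBA
        have hcard : (A.erase e).card < B.card := by
          have := Finset.card_erase_lt_of_mem he
          rw [h.card A hAF] at this
          rwa [h.card B hB]
        obtain ⟨b, hb, hbA⟩ := Finset.exists_mem_notMem_of_card_lt_card hcard
        refine ⟨_, mem_stackedFacets.2 (Or.inr ⟨b, hb, rfl⟩), ?_, ?_⟩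
        · rw [Finset.mem_insert, not_or]
          exact ⟨fun hex => hxV (hex ▸ h.subset hAF he), fun h' => heB (Finset.mem_of_mem_erase h')⟩
        · exact fun y hy => Finset.mem_insert_of_mem
            (Finset.mem_erase.2 ⟨fun hyb => hbA (hyb ▸ hy), hsub hy⟩)
      · exact ⟨B, mem_stackedFacets.2 (Or.inl ⟨hBA, hB⟩), heB, hsub⟩
    · by_cases hex : e = x
      · subst hex
        obtain ⟨B, hB, haB, hsub⟩ := h.neighbor A₀ hA₀ a ha
        refine ⟨B, mem_stackedFacets.2 (Or.inl ⟨fun hBA => haB (hBA ▸ ha), hB⟩),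
          fun heB => hxV (h.subset hB heB), ?_⟩
        rwa [Finset.erase_insert fun e' => hxA (Finset.mem_of_mem_erase e')]
      · have heA : e ∈ A₀ :=
          Finset.mem_of_mem_erase ((Finset.mem_insert.1 he).resolve_left hex)
        refine ⟨_, mem_stackedFacets.2 (Or.inr ⟨e, heA, rfl⟩), ?_, ?_⟩
        · simp [hex]
        · intro y hy
          simp only [Finset.mem_erase, Finset.mem_insert] at hy ⊢
          tauto

end Stack

end IsFacetSystem

end FacetSystems

/-! ### Counting faces -/

section Counting

variable {E : Type*} [NormedAddCommGroup E] [NormedSpace ℝ E] [DecidableEq E]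

/-- The vertex sets of the proper faces (the empty one included) of the simplicial polytope with
facets `𝓕`. -/
def properFaces (𝓕 : Finset (Finset E)) : Finset (Finset E) :=
  𝓕.biUnion Finset.powerset

omit [NormedAddCommGroup E] [NormedSpace ℝ E] in
theorem mem_properFaces {𝓕 : Finset (Finset E)} {W : Finset E} :
    W ∈ properFaces 𝓕 ↔ ∃ A ∈ 𝓕, W ⊆ A := by
  simp [properFaces]

namespace IsFacetSystem

variable {d : ℕ} {V : Finset E} {𝓕 : Finset (Finset E)}

/-- Stacking removes the face `A₀` and adds the pyramids over the proper subsets of `A₀`. -/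
theorem properFaces_stackedFacets (h : IsFacetSystem d V 𝓕) {A₀ : Finset E} (hA₀ : A₀ ∈ 𝓕)
    {x : E} (hx : x ∉ V) :
    properFaces (stackedFacets 𝓕 A₀ x) =
      (properFaces 𝓕).erase A₀ ∪ A₀.ssubsets.image (insert x) := by
  have hxA : x ∉ A₀ := fun hxA => hx (h.subset hA₀ hxA)
  ext W
  simp only [mem_properFaces, mem_stackedFacets, Finset.mem_union, Finset.mem_erase,
    Finset.mem_image, Finset.mem_ssubsets]
  constructor
  · rintro ⟨A, ⟨hne, hA⟩ | ⟨a, ha, rfl⟩, hWA⟩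
    · refine Or.inl ⟨?_, A, hA, hWA⟩
      rintro rfl
      exact hne (Finset.eq_of_subset_of_card_le hWA (by rw [h.card A hA, h.card W hA₀])).symm
    · by_cases hxW : x ∈ W
      · refine Or.inr ⟨W.erase x, ?_, Finset.insert_erase hxW⟩
        refine lt_of_le_of_lt ?_ (Finset.erase_ssubset ha)
        exact fun y hy => (Finset.mem_insert.1 (hWA (Finset.mem_of_mem_erase hy))).resolve_left
          (Finset.ne_of_mem_erase hy)
      · have hW : W ⊆ A₀.erase a := (Finset.subset_insert_iff_of_notMem hxW).1 hWA
        refine Or.inl ⟨?_, A₀, hA₀, hW.trans (Finset.erase_subset _ _)⟩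
        rintro rfl
        exact absurd (hW ha) (Finset.notMem_erase _ _)
  · have hproper : ∀ W ⊂ A₀, ∃ a ∈ A₀, W ⊆ A₀.erase a := by
      intro W hW
      obtain ⟨a, ha, haW⟩ := Finset.exists_of_ssubset hW
      exact ⟨a, ha, fun w hw => Finset.mem_erase.2 ⟨fun e => haW (e ▸ hw), hW.1 hw⟩⟩
    rintro (⟨hne, A, hA, hWA⟩ | ⟨W, hW, rfl⟩)
    · by_cases hAA : A = A₀
      · subst hAA
        obtain ⟨a, ha, haW⟩ := hproper W (hWA.ssubset_of_ne hne)
        exact ⟨_, Or.inr ⟨a, ha, rfl⟩, haW.trans (Finset.subset_insert _ _)⟩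
      · exact ⟨A, Or.inl ⟨hAA, hA⟩, hWA⟩
    · obtain ⟨a, ha, haW⟩ := hproper W hW
      exact ⟨_, Or.inr ⟨a, ha, rfl⟩, Finset.insert_subset_insert _ haW⟩

theorem card_filter_properFaces_stackedFacets (h : IsFacetSystem d V 𝓕) {A₀ : Finset E}
    (hA₀ : A₀ ∈ 𝓕) {x : E} (hx : x ∉ V) (p : ℕ → Prop) [DecidablePred p] :
    ((properFaces (stackedFacets 𝓕 A₀ x)).filter fun W => p W.card).card + (if p d then 1 else 0) =
      ((properFaces 𝓕).filter fun W => p W.card).card +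
        (A₀.ssubsets.filter fun W => p (W.card + 1)).card := by
  have hxA : ∀ W ∈ properFaces 𝓕, x ∉ W := by
    intro W hW hxW
    obtain ⟨A, hA, hWA⟩ := mem_properFaces.1 hW
    exact hx (h.subset hA (hWA hxW))
  have hxS : ∀ W ∈ A₀.ssubsets, x ∉ W := fun W hW hxW =>
    hx (h.subset hA₀ ((Finset.mem_ssubsets.1 hW).1 hxW))
  have hdisj : Disjoint (((properFaces 𝓕).erase A₀).filter fun W => p W.card)
      ((A₀.ssubsets.image (insert x)).filter fun W => p W.card) := by
    rw [Finset.disjoint_left]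
    intro W hW hW'
    obtain ⟨U, -, rfl⟩ := Finset.mem_image.1 (Finset.mem_filter.1 hW').1
    exact hxA _ (Finset.mem_of_mem_erase (Finset.mem_filter.1 hW).1) (Finset.mem_insert_self _ _)
  have himage : ((A₀.ssubsets.image (insert x)).filter fun W => p W.card).card =
      (A₀.ssubsets.filter fun W => p (W.card + 1)).card := by
    rw [Finset.filter_image, Finset.card_image_of_injOn]
    · refine congrArg _ (Finset.filter_congr fun W hW => ?_)
      rw [Finset.card_insert_of_notMem (hxS W hW)]
    · intro U hU W hW hUW
      have hU' := hxS U (Finset.mem_filter.1 hU).1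
      have hW' := hxS W (Finset.mem_filter.1 hW).1
      rw [← Finset.erase_insert hU', ← Finset.erase_insert hW']
      exact congrArg (fun T => T.erase x) hUW
  have hA₀K : A₀ ∈ properFaces 𝓕 := mem_properFaces.2 ⟨A₀, hA₀, subset_rfl⟩
  have herase : (((properFaces 𝓕).erase A₀).filter fun W => p W.card).card +
      (if p d then 1 else 0) = ((properFaces 𝓕).filter fun W => p W.card).card := by
    conv_rhs => rw [← Finset.insert_erase hA₀K]
    rw [Finset.filter_insert, h.card A₀ hA₀]
    split_ifs with hp
    · rw [Finset.card_insert_of_notMem]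
      simp
    · rfl
  rw [h.properFaces_stackedFacets hA₀ hx, Finset.filter_union, Finset.card_union_of_disjoint hdisj,
    himage, ← herase]
  ring

theorem vertices_nonempty (h : IsFacetSystem d V 𝓕) (hd : 0 < d) : V.Nonempty := by
  obtain ⟨A, hA⟩ := h.nonempty
  exact (Finset.card_pos.1 (by rw [h.card A hA]; exact hd)).mono (h.subset hA)

theorem convexDim_eq (h : IsFacetSystem d V 𝓕) (hd : 0 < d) :
    convexDim (convexHull ℝ (V : Set E)) = d := by
  rw [convexDim_convexHull (by simpa using h.vertices_nonempty hd), h.finrank]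

theorem convexDim_of_mem_properFaces (h : IsFacetSystem d V 𝓕) {W : Finset E}
    (hW : W ∈ properFaces 𝓕) : convexDim (convexHull ℝ (W : Set E)) = (W.card : ℤ) - 1 := by
  obtain ⟨A, hA, hWA⟩ := mem_properFaces.1 hW
  exact AffineIndependent.convexDim_convexHull ((h.indep A hA).mono (Finset.coe_subset.2 hWA))

theorem notMem_properFaces (h : IsFacetSystem d V 𝓕) (hd : 0 < d) : V ∉ properFaces 𝓕 := by
  intro hV
  have h1 := h.convexDim_of_mem_properFaces hV
  rw [h.convexDim_eq hd] at h1
  obtain ⟨A, hA, hVA⟩ := mem_properFaces.1 hV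
  have h2 := Finset.card_le_card hVA
  rw [h.card A hA] at h2
  omega

variable [FiniteDimensional ℝ E]

theorem exists_exposes (h : IsFacetSystem d V 𝓕) {W : Finset E}
    (hW : W ∈ insert V (properFaces 𝓕)) :
    ∃ (l : StrongDual ℝ E) (c : ℝ), Exposes V W l c := by
  rcases Finset.mem_insert.1 hW with rfl | hW
  · exact ⟨0, 0, exposes_self _⟩
  · obtain ⟨A, hA, hWA⟩ := mem_properFaces.1 hW
    obtain ⟨l, c, hl⟩ := h.exposed A hA
    exact hl.exists_of_subset (h.indep A hA) hWA

theorem isFace_iff (h : IsFacetSystem d V 𝓕) (hd : 0 < d) {F : Set E} :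
    IsFace (convexHull ℝ (V : Set E)) F ↔
      ∃ W ∈ insert V (properFaces 𝓕), convexHull ℝ (W : Set E) = F := by
  rw [isFace_convexHull_iff (h.vertices_nonempty hd)]
  constructor
  · rintro ⟨W, l, c, hW, rfl⟩
    refine ⟨W, ?_, rfl⟩
    rw [Finset.mem_insert, mem_properFaces]
    exact h.eq_or_subset W l c hW
  · rintro ⟨W, hW, rfl⟩
    obtain ⟨l, c, hl⟩ := h.exists_exposes hW
    exact ⟨W, l, c, hl, rfl⟩

theorem isFacet_iff (h : IsFacetSystem d V 𝓕) (hd : 0 < d) {F : Set E} :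
    IsFacet (convexHull ℝ (V : Set E)) F ↔ ∃ A ∈ 𝓕, convexHull ℝ (A : Set E) = F := by
  rw [IsFacet, h.convexDim_eq hd, h.isFace_iff hd]
  constructor
  · rintro ⟨⟨W, hW, rfl⟩, hdim⟩
    rcases Finset.mem_insert.1 hW with rfl | hW
    · rw [h.convexDim_eq hd] at hdim
      omega
    · rw [h.convexDim_of_mem_properFaces hW] at hdim
      obtain ⟨A, hA, hWA⟩ := mem_properFaces.1 hW
      have := Finset.eq_of_subset_of_card_le hWA (by rw [h.card A hA]; omega)
      exact ⟨W, this ▸ hA, rfl⟩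
  · rintro ⟨A, hA, rfl⟩
    have hAK : A ∈ properFaces 𝓕 := mem_properFaces.2 ⟨A, hA, subset_rfl⟩
    refine ⟨⟨A, Finset.mem_insert_of_mem hAK, rfl⟩, ?_⟩
    rw [h.convexDim_of_mem_properFaces hAK, h.card A hA]

/-- Distinct exposed vertex sets span distinct faces, so that faces can be counted by vertex sets. -/
theorem ncard_faces (h : IsFacetSystem d V 𝓕) (hd : 0 < d) (Q : ℤ → Prop) [DecidablePred Q] :
    {F : Set E | IsFace (convexHull ℝ (V : Set E)) F ∧ Q (convexDim F)}.ncard =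
      ((properFaces 𝓕).filter fun W => Q ((W.card : ℤ) - 1)).card + if Q d then 1 else 0 := by
  have himage : {F : Set E | IsFace (convexHull ℝ (V : Set E)) F ∧ Q (convexDim F)} =
      (fun W : Finset E => convexHull ℝ (W : Set E)) ''
        ((insert V (properFaces 𝓕)).filter fun W : Finset E =>
          Q (convexDim (convexHull ℝ (W : Set E))) : Finset (Finset E)) := by
    ext F
    simp only [Set.mem_ofPred_eq, h.isFace_iff hd, Set.mem_image, Finset.mem_coe, Finset.mem_filter]
    constructor
    · rintro ⟨⟨W, hW, rfl⟩, hQ⟩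
      exact ⟨W, ⟨hW, hQ⟩, rfl⟩
    · rintro ⟨W, ⟨hW, hQ⟩, rfl⟩
      exact ⟨⟨W, hW, rfl⟩, hQ⟩
  rw [himage, Set.InjOn.ncard_image, Set.ncard_coe_finset, Finset.filter_insert,
    h.convexDim_eq hd, Finset.filter_congr fun W hW => by rw [h.convexDim_of_mem_properFaces hW]]
  · split_ifs with hQ
    · rw [Finset.card_insert_of_notMem fun hV => h.notMem_properFaces hd (Finset.mem_filter.1 hV).1]
    · rfl
  · intro U hU W hW hUW
    obtain ⟨l, c, hl⟩ := h.exists_exposes (Finset.mem_filter.1 hU).1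
    obtain ⟨l', c', hl'⟩ := h.exists_exposes (Finset.mem_filter.1 hW).1
    exact hl.eq_of_convexHull_eq hl' hUW

/-- The boundary of a simplex is a facet system. -/
theorem of_simplex (hV : AffineIndependent ℝ ((↑) : V → E)) (hcard : V.card = d + 1) :
    IsFacetSystem d V (V.image V.erase) := by
  have hmem : ∀ {A : Finset E}, A ∈ V.image V.erase ↔ ∃ v ∈ V, V.erase v = A := Finset.mem_image
  refine ⟨?_, ?_, ?_, ?_, ?_, ?_, ?_⟩
  · have := hV.finrank_vectorSpan (n := d) (by rw [Fintype.card_coe, hcard])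
    rwa [show Set.range ((↑) : V → E) = (V : Set E) by simp] at this
  · exact (Finset.card_pos.1 (by omega)).image _
  · intro A hA
    obtain ⟨v, hv, rfl⟩ := hmem.1 hA
    rw [Finset.card_erase_of_mem hv, hcard, Nat.add_sub_cancel]
  · intro A hA
    obtain ⟨v, hv, rfl⟩ := hmem.1 hA
    exact hV.mono (Finset.coe_subset.2 (Finset.erase_subset _ _))
  · intro A hA
    obtain ⟨v, hv, rfl⟩ := hmem.1 hA
    exact (exposes_self V).exists_of_subset hV (Finset.erase_subset _ _)
  · intro A hA a ha
    obtain ⟨v, hv, rfl⟩ := hmem.1 hA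
    exact ⟨V.erase a, hmem.2 ⟨a, Finset.mem_of_mem_erase ha, rfl⟩, Finset.notMem_erase _ _,
      Finset.erase_subset_erase _ (Finset.erase_subset _ _)⟩
  · intro W l c hW
    by_cases he : W = V
    · exact Or.inl he
    · obtain ⟨v, hv, hvW⟩ := Finset.exists_of_ssubset (hW.subset.ssubset_of_ne he)
      exact Or.inr ⟨_, hmem.2 ⟨v, hv, rfl⟩,
        fun w hw => Finset.mem_erase.2 ⟨fun e => hvW (e ▸ hw), hW.subset hw⟩⟩

end IsFacetSystem

omit [NormedAddCommGroup E] [NormedSpace ℝ E] in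
theorem properFaces_image_erase (V : Finset E) : properFaces (V.image V.erase) = V.ssubsets := by
  ext W
  simp only [mem_properFaces, Finset.mem_image, Finset.mem_ssubsets]
  constructor
  · rintro ⟨_, ⟨v, hv, rfl⟩, hW⟩
    exact lt_of_le_of_lt hW (Finset.erase_ssubset hv)
  · intro hW
    obtain ⟨v, hv, hvW⟩ := Finset.exists_of_ssubset hW
    exact ⟨_, ⟨v, hv, rfl⟩, fun w hw => Finset.mem_erase.2 ⟨fun e => hvW (e ▸ hw), hW.1 hw⟩⟩

/-- The number of subsets of a `d`-element set whose cardinality satisfies `p`. -/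
def subsetCount (d : ℕ) (p : ℕ → Prop) [DecidablePred p] : ℕ :=
  ((Finset.range d).powerset.filter fun s => p s.card).card

theorem card_filter_powerset {α : Type*} (A : Finset α) (p : ℕ → Prop) [DecidablePred p] :
    (A.powerset.filter fun s => p s.card).card = subsetCount A.card p := by
  simp only [subsetCount, Finset.card_filter]
  rw [Finset.sum_powerset_apply_card (fun i => if p i then 1 else 0),
    Finset.sum_powerset_apply_card (fun i => if p i then 1 else 0), Finset.card_range]

theorem card_filter_ssubsets {α : Type*} [DecidableEq α] (A : Finset α) (p : ℕ → Prop)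
    [DecidablePred p] :
    (A.ssubsets.filter fun s => p s.card).card + (if p A.card then 1 else 0) =
      subsetCount A.card p := by
  rw [← card_filter_powerset, ← Finset.insert_erase (Finset.mem_powerset_self A),
    Finset.filter_insert]
  change ((A.powerset.erase A).filter _).card + _ = _
  split_ifs with hp
  · rw [Finset.card_insert_of_notMem]
    simp
  · rfl

open Classical in
/-- A stacked polytope obtained by `t` stackings is a simplicial polytope whose proper faces can be
counted by their number of vertices: each stacking removes one facet and adds one face for every
proper subset of it. -/
theorem IsStackedPolytope.exists_isFacetSystem [FiniteDimensional ℝ E] {d : ℕ} (hd : 0 < d)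
    {P : Set E} (hP : IsStackedPolytope d P) :
    ∃ (V : Finset E) (𝓕 : Finset (Finset E)) (t : ℕ), IsFacetSystem d V 𝓕 ∧
      P = convexHull ℝ (V : Set E) ∧ ∀ p : ℕ → Prop,
        ((properFaces 𝓕).filter fun W => p W.card).card + (if p (d + 1) then 1 else 0) +
            t * ((if p d then 1 else 0) + (if p (d + 1) then 1 else 0)) =
          subsetCount (d + 1) p + t * subsetCount d fun i => p (i + 1) := by
  induction hP with
  | simplex p hp =>
    have hcoe : ((Finset.univ.image p : Finset E) : Set E) = Set.range p := by simp
    have hcard : (Finset.univ.image p).card = d + 1 := by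
      rw [Finset.card_image_of_injective _ hp.injective, Finset.card_univ, Fintype.card_fin]
    have hind : AffineIndependent ℝ ((↑) : ↥(Finset.univ.image p) → E) := by
      have := hp.range
      rw [← hcoe] at this
      exact this
    refine ⟨Finset.univ.image p, _, 0, IsFacetSystem.of_simplex hind hcard, by rw [hcoe], ?_⟩
    intro q
    have := card_filter_ssubsets (Finset.univ.image p) q
    rw [hcard] at this
    rw [properFaces_image_erase, this]
    ring
  | stack P Q hP hQ ih =>
    obtain ⟨V, 𝓕, t, h, rfl, hcount⟩ := ih
    obtain ⟨F, x, hF, hx, ⟨l₀, hFl₀, hl₀x⟩, hbeneath, rfl⟩ := hQ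
    obtain ⟨A₀, hA₀, rfl⟩ := (h.isFacet_iff hd).1 hF
    rw [affineSpan_convexHull] at hx
    have hne : ∀ A ∈ 𝓕, A.Nonempty := fun A hA =>
      Finset.card_pos.1 (by rw [h.card A hA]; exact hd)
    have hexp : ∀ A ∈ 𝓕, A ∈ insert V (properFaces 𝓕) := fun A hA =>
      Finset.mem_insert_of_mem (mem_properFaces.2 ⟨A, hA, subset_rfl⟩)
    obtain ⟨a₀, ha₀⟩ := hne A₀ hA₀
    obtain ⟨l₁, c₁, hl₁⟩ := h.exists_exposes (hexp A₀ hA₀)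
    have hl₀ := hl₁.of_convexHull_eq_maximizers ha₀ hFl₀
    have hbeyond := hl₀x a₀ (subset_convexHull ℝ _ (Finset.mem_coe.2 ha₀))
    have hbeneath' : ∀ B ∈ 𝓕, B ≠ A₀ →
        ∃ (l : StrongDual ℝ E) (c : ℝ), Exposes V B l c ∧ l x < c := by
      intro B hB hBA
      obtain ⟨l₂, c₂, hl₂⟩ := h.exists_exposes (hexp B hB)
      obtain ⟨l, hBl, hlx⟩ := hbeneath _ ((h.isFacet_iff hd).2 ⟨B, hB, rfl⟩)
        fun e => hBA (hl₂.eq_of_convexHull_eq hl₁ e)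
      obtain ⟨b, hb⟩ := hne B hB
      exact ⟨l, l b, hl₂.of_convexHull_eq_maximizers hb hBl,
        hlx b (subset_convexHull ℝ _ (Finset.mem_coe.2 hb))⟩
    have hxV : x ∉ V := fun hxV => hbeyond.not_ge (hl₀.le hxV)
    refine ⟨insert x V, stackedFacets 𝓕 A₀ x, t + 1,
      h.stack hd hA₀ hx hl₀ hbeyond hbeneath', ?_, fun p => ?_⟩
    · rw [Finset.coe_insert]
      refine Set.Subset.antisymm (convexHull_min (Set.insert_subset
        (subset_convexHull ℝ _ (Set.mem_insert _ _)) (convexHull_mono (Set.subset_insert _ _)))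
        (convex_convexHull ℝ _)) (convexHull_mono (Set.insert_subset_insert
        (subset_convexHull ℝ _)))
    · have h1 := h.card_filter_properFaces_stackedFacets hA₀ hxV p
      have h2 := card_filter_ssubsets A₀ fun i => p (i + 1)
      have h3 := hcount p
      rw [h.card A₀ hA₀] at h2
      generalize ((properFaces (stackedFacets 𝓕 A₀ x)).filter fun W => p W.card).card = N' at h1 ⊢
      linarith

open Classical in
/-- The faces of a stacked polytope, counted by dimension. The correction multiplied by
`t` on the left accounts for the facets covered by a stacking, which cease to be faces, and for the
pyramids over them, which are not faces of the new polytope. -/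
theorem IsStackedPolytope.exists_ncard_faces [FiniteDimensional ℝ E] {d : ℕ} (hd : 0 < d)
    {P : Set E} (hP : IsStackedPolytope d P) :
    ∃ t : ℕ, ∀ Q : ℤ → Prop,
      {F : Set E | IsFace P F ∧ Q (convexDim F)}.ncard +
          t * ((if Q ((d : ℤ) - 1) then 1 else 0) + (if Q d then 1 else 0)) =
        subsetCount (d + 1) (fun i => Q ((i : ℤ) - 1)) + t * subsetCount d fun i => Q i := by
  obtain ⟨V, 𝓕, t, h, rfl, hcount⟩ := hP.exists_isFacetSystem hd
  refine ⟨t, fun Q => ?_⟩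
  have := hcount fun i => Q ((i : ℤ) - 1)
  simp only [Nat.cast_add, Nat.cast_one, add_sub_cancel_right] at this
  rw [h.ncard_faces hd Q, this]

end Counting

/-! ### Subsets with cardinality in a residue class -/

section Asymptotics

theorem subsetCount_congr {d : ℕ} {p q : ℕ → Prop} {_ : DecidablePred p} {_ : DecidablePred q}
    (h : ∀ i, p i ↔ q i) : subsetCount d p = subsetCount d q :=
  congrArg Finset.card (Finset.filter_congr fun s _ => h s.card)

theorem subsetCount_eq_choose (d j : ℕ) : subsetCount d (fun i => i = j) = d.choose j := by
  rw [subsetCount, ← Finset.powersetCard_eq_filter, Finset.card_powersetCard, Finset.card_range]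

/-- The roots of unity filter. -/
theorem mul_subsetCount_eq_sum {m : ℕ} [NeZero m] (z : ZMod m) (d : ℕ) :
    (m : ℂ) * subsetCount d (fun i => (i : ZMod m) = z) =
      ∑ a : ZMod m, ZMod.stdAddChar (-(a * z)) * (1 + ZMod.stdAddChar a) ^ d := by
  have hpow : ∀ a : ZMod m, (1 + ZMod.stdAddChar a : ℂ) ^ d =
      ∑ s ∈ (Finset.range d).powerset, ZMod.stdAddChar (a * (s.card : ZMod m)) := by
    intro a
    have := Finset.prod_one_add (f := fun _ => (ZMod.stdAddChar a : ℂ)) (Finset.range d)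
    simp only [Finset.prod_const, Finset.card_range] at this
    rw [this]
    refine Finset.sum_congr rfl fun s _ => ?_
    rw [mul_comm, ← nsmul_eq_mul, AddChar.map_nsmul_eq_pow]
  simp only [hpow, Finset.mul_sum, ← AddChar.map_add_eq_mul]
  rw [Finset.sum_comm, subsetCount, Finset.card_filter, Nat.cast_sum, Finset.mul_sum]
  refine Finset.sum_congr rfl fun s _ => ?_
  have := AddChar.sum_mulShift ((s.card : ZMod m) - z) (ZMod.isPrimitive_stdAddChar m)
  simp only [sub_eq_zero, ZMod.card] at this
  rw [Nat.cast_ite, Nat.cast_one, Nat.cast_zero, mul_ite, mul_one, mul_zero]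
  rw [Nat.cast_ite, Nat.cast_zero] at this
  rw [← this]
  exact Finset.sum_congr rfl fun a _ => congrArg _ (by ring)

theorem norm_one_add_stdAddChar_lt {m : ℕ} [NeZero m] {a : ZMod m} (ha : a ≠ 0) :
    ‖(1 + ZMod.stdAddChar a : ℂ) / 2‖ < 1 := by
  have h1 : ‖(ZMod.stdAddChar a : ℂ)‖ = 1 := by rw [ZMod.stdAddChar_apply]; exact Circle.norm_coe _
  have hne : (1 : ℂ) ≠ ZMod.stdAddChar a := by
    rw [← (ZMod.stdAddChar (N := m)).map_zero_eq_one]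
    exact fun h => ha (ZMod.injective_stdAddChar h).symm
  have hle := norm_add_le (1 : ℂ) (ZMod.stdAddChar a)
  have hlt : ‖(1 + ZMod.stdAddChar a : ℂ)‖ < ‖(1 : ℂ)‖ + ‖(ZMod.stdAddChar a : ℂ)‖ :=
    lt_of_le_of_ne hle fun h => hne (eq_of_norm_eq_of_norm_add_eq (by rw [h1, norm_one]) h)
  rw [h1, norm_one] at hlt
  rw [norm_div, Complex.norm_ofNat]
  linarith

/-- The cardinalities of the subsets of a large finite set are equidistributed mod `m`: in the roots
of unity filter, only the trivial character contributes a term of order `2 ^ d`. -/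
theorem tendsto_subsetCount_div_two_pow {m : ℕ} [NeZero m] (z : ZMod m) :
    Tendsto (fun d => (subsetCount d (fun i => (i : ZMod m) = z) : ℝ) / 2 ^ d) atTop
      (𝓝 (1 / m)) := by
  have hm : (m : ℂ) ≠ 0 := Nat.cast_ne_zero.2 (NeZero.ne m)
  have hlim : Tendsto (fun d : ℕ => (1 / m : ℂ) *
      ∑ a : ZMod m, ZMod.stdAddChar (-(a * z)) * ((1 + ZMod.stdAddChar a) / 2) ^ d) atTop
      (𝓝 ((1 / m : ℂ) * ∑ a : ZMod m, if a = 0 then 1 else 0)) := by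
    refine (tendsto_finsetSum _ fun a _ => ?_).const_mul _
    split_ifs with ha
    · subst ha
      simp only [zero_mul, neg_zero, AddChar.map_zero_eq_one, one_mul, one_add_one_eq_two]
      rw [div_self two_ne_zero]
      simp
    · have := (tendsto_pow_atTop_nhds_zero_of_norm_lt_one
        (norm_one_add_stdAddChar_lt ha)).const_mul (ZMod.stdAddChar (-(a * z)) : ℂ)
      rwa [mul_zero] at this
  rw [Finset.sum_ite_eq' Finset.univ (0 : ZMod m), if_pos (Finset.mem_univ _), mul_one] at hlim
  rw [← tendsto_ofReal_iff]
  push_cast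
  refine hlim.congr fun d => ?_
  simp only [div_pow, ← mul_div_assoc, ← Finset.sum_div]
  rw [← mul_subsetCount_eq_sum]
  field_simp

theorem tendsto_modularFVector_div_two_pow (n : ℕ) (N : ℕ → ℕ)
    (S : (k : ℕ) → Set (EuclideanSpace ℝ (Fin (N k))))
    (hS : ∀ k : ℕ, 2 ≤ k → IsStackedPolytope k (S k))
    (hv : ∀ k : ℕ, 2 ≤ k → fVector (S k) 0 = k + 1 + n) {m : ℕ} [NeZero m] (j : Fin m) :
    Tendsto (fun k => (modularFVector m (S k) j : ℝ) / 2 ^ k) atTop (𝓝 ((n + 2) / m)) := by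
  classical
  set p : ℕ → Prop := fun i => (i : ZMod m) = (j : ℕ) with hp
  set q : ℕ → Prop := fun i => (i : ZMod m) = (j : ℕ) - 1 with hq
  have hcount : ∀ k, 2 ≤ k → ∃ ε : ℕ, ε ≤ 2 ∧
      modularFVector m (S k) j + n * ε = subsetCount (k + 1) p + n * subsetCount k q := by
    intro k hk
    obtain ⟨t, ht⟩ := (hS k hk).exists_ncard_faces (by omega)
    -- The number of stackings is determined by the number of vertices.
    have htn : t = n := by
      have h0 := ht fun i => i = 0
      have hvk := hv k hk
      rw [fVector] at hvk
      rw [hvk, if_neg (by omega), if_neg (by omega), subsetCount_congr (q := fun i => i = 1)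
        fun i => by omega, subsetCount_congr (d := k) (q := fun i => i = 0) fun i => by omega,
        subsetCount_eq_choose, subsetCount_eq_choose, Nat.choose_one_right,
        Nat.choose_zero_right] at h0
      omega
    subst htn
    refine ⟨_, ?_, (ht fun i => i ≡ (j : ℤ) - 1 [ZMOD (m : ℤ)]).trans ?_⟩
    · split_ifs <;> omega
    · congr 1
      · refine subsetCount_congr fun i => ?_
        rw [hp, ← ZMod.intCast_eq_intCast_iff]
        push_cast
        exact sub_left_inj (a := (1 : ZMod m))
      · refine congrArg _ (subsetCount_congr fun i => ?_)
        rw [hq, ← ZMod.intCast_eq_intCast_iff]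
        push_cast
        exact Iff.rfl
  have hmain := ((((tendsto_add_atTop_iff_nat 1).2 (tendsto_subsetCount_div_two_pow
    ((j : ℕ) : ZMod m))).const_mul 2).add ((tendsto_subsetCount_div_two_pow
    (((j : ℕ) : ZMod m) - 1)).const_mul (n : ℝ)))
  have hhalf : Tendsto (fun k : ℕ => (2 * n : ℝ) * (1 / 2) ^ k) atTop (𝓝 0) := by
    have := (tendsto_pow_atTop_nhds_zero_of_lt_one (r := (1 / 2 : ℝ)) (by norm_num)
      (by norm_num)).const_mul (2 * n : ℝ)
    rwa [mul_zero] at this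
  have hlim : (2 : ℝ) * (1 / m) + n * (1 / m) = (n + 2) / m := by ring
  rw [hlim] at hmain
  have hlow := hmain.sub hhalf
  rw [sub_zero] at hlow
  have heq : ∀ k : ℕ, (2 : ℝ) * ((subsetCount (k + 1) p : ℝ) / 2 ^ (k + 1)) +
      n * ((subsetCount k q : ℝ) / 2 ^ k) =
      ((subsetCount (k + 1) p + n * subsetCount k q : ℕ) : ℝ) / 2 ^ k := by
    intro k
    push_cast
    rw [pow_succ]
    field_simp
  -- The bounded error `n * ε` is negligible against `2 ^ k`.
  refine tendsto_of_tendsto_of_tendsto_of_le_of_le' hlow hmain ?_ ?_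
  · filter_upwards [eventually_ge_atTop 2] with k hk
    obtain ⟨ε, hε, hc⟩ := hcount k hk
    rw [heq, ← hc, one_div, inv_pow, ← div_eq_mul_inv, ← sub_div]
    refine div_le_div_of_nonneg_right ?_ (by positivity)
    have : (ε : ℝ) ≤ 2 := by exact_mod_cast hε
    have := mul_le_mul_of_nonneg_left this (Nat.cast_nonneg (α := ℝ) n)
    push_cast
    linarith
  · filter_upwards [eventually_ge_atTop 2] with k hk
    obtain ⟨ε, hε, hc⟩ := hcount k hk
    rw [heq, ← hc]
    refine div_le_div_of_nonneg_right ?_ (by positivity)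
    exact_mod_cast Nat.le_add_right _ _

end Asymptotics

/-! ### The limit -/

theorem theorem2 (n : ℕ) (N : ℕ → ℕ) (S : (k : ℕ) → Set (EuclideanSpace ℝ (Fin (N k))))
    (hS : ∀ k : ℕ, 2 ≤ k → IsStackedPolytope k (S k))
    (hv : ∀ k : ℕ, 2 ≤ k → fVector (S k) 0 = k + 1 + n)
    (m : ℕ) (hm : 0 < m) :
    Tendsto
      (fun k : ℕ => fun j : Fin m =>
        (modularFVector m (S k) j : ℝ) / (modularFVector 1 (S k) 0 : ℝ))
      atTop (𝓝 (fun _ : Fin m => (1 : ℝ) / (m : ℝ))) := by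
  have : NeZero m := ⟨hm.ne'⟩
  rw [tendsto_pi_nhds]
  intro j
  have hn : ((n : ℝ) + 2) / (1 : ℕ) ≠ 0 := by positivity
  have h := (tendsto_modularFVector_div_two_pow n N S hS hv j).div
    (tendsto_modularFVector_div_two_pow n N S hS hv (0 : Fin 1)) hn
  have hval : ((n : ℝ) + 2) / m / ((n + 2) / (1 : ℕ)) = 1 / m := by
    have : (n : ℝ) + 2 ≠ 0 := by positivity
    field_simp
    simp
  rw [hval] at h
  refine h.congr fun k => ?_
  exact div_div_div_cancel_right₀ (by positivity) _ _
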